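/- Let $H$ be a separable real Hilbert space and let $\mathcal P_2(H)$ be the set of Borel probability measures on $H$ with finite quadratic moment, endowed with the topology of the $L^2$-Wasserstein metric. Let $(Q,\mathcal F_Q,\mathbb P)$ be a standard Borel space with a nonatomic probability measure, $L^2(Q;H)=L^2(Q,\mathcal F_Q,\mathbb P;H)$ and $\iota:L^2(Q;H)\to\mathcal P_2(H)$, $\iota(X):=X_\sharp\mathbb P$. For $\mu,\nu\in\mathcal P_2(H)$ put $$[\mu,\nu]:=\max\Big\{\int_{H\times H}\langle x,y\rangle\,d\gamma(x,y):\ \gamma \text{ a coupling with marginals } \mu \text{ and } \nu\Big\}.$$ For $\psi:\mathcal P_2(H)\to[-\infty,+\infty]$ let $\psi^\star(\nu):=\sup_{\mu\in\mathcal P_2(H)}\big([\nu,\mu]-\psi(\mu)\big)$ for $\nu\in\mathcal P_2(H)$. A function $\phi:\mathcal P_2(H)\to\mathbb R\cup\{+\infty\}$ is \emph{proper} if it is not identically $+\infty$, and \emph{totally convex} if for every $\gamma\in\mathcal P_2(H\times H)$ and every $t\in[0,1]$ $$\phi(\mu_t)\le(1-t)\,\phi(\mu_0)+t\,\phi(\mu_1),\qquad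 \mu_s:=\big((x_1,x_2)\mapsto(1-s)x_1+s x_2\big)_\sharp\gamma\quad (s\in[0,1]),$$ with the convention $0\cdot(+\infty)=0$. Let $\phi:\mathcal P_2(H)\to\mathbb R\cup\{+\infty\}$ be proper. Then the following are equivalent: 1. $\phi$ is totally convex and lower semicontinuous on $\mathcal P_2(H)$; 2. $\phi\circ\iota$ is convex and lower semicontinuous on $L^2(Q;H)$; 3. $\phi=\phi^{\star\star}:=(\phi^\star)^\star$; 4. there exists a set $G\subset\mathcal P_2(H)\times\mathbb R$ such that $\phi(\mu)=\sup_{(\nu,a)\in G}\big([\mu,\nu]-a\big)$ for every $\mu\in\mathcal P_2(H)$. -/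

import Mathlib

open MeasureTheory
open scoped ENNReal

/-- Borel probability measures on a normed space `E` with finite quadratic moment.
For `E = H × H` the (equivalent) sup norm of the product is used, so the moment is finite
iff both marginals have finite quadratic moment. -/
@[ext]
structure P2 (E : Type*) [NormedAddCommGroup E] [MeasurableSpace E] where
  toMeasure : Measure E
  isProbabilityMeasure : IsProbabilityMeasure toMeasure
  memLp_id : MemLp id 2 toMeasure

namespace P2

section Map

variable {E F : Type*} [NormedAddCommGroup E] [NormedSpace ℝ E] [MeasurableSpace E] [BorelSpace E]
  [NormedAddCommGroup F] [NormedSpace ℝ F] [MeasurableSpace F] [BorelSpace F]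
  [SecondCountableTopology F]

/-- Push-forward of a measure with finite quadratic moment under a continuous linear map. -/
noncomputable def map (L : E →L[ℝ] F) (μ : P2 E) : P2 F where
  toMeasure := μ.toMeasure.map L
  isProbabilityMeasure :=
    haveI := μ.isProbabilityMeasure
    Measure.isProbabilityMeasure_map L.continuous.measurable.aemeasurable
  memLp_id := by
    rw [memLp_map_measure_iff continuous_id.aestronglyMeasurable
      L.continuous.measurable.aemeasurable]
    exact L.comp_memLp' μ.memLp_id

end Map

section Hilbert

variable {H : Type*} [NormedAddCommGroup H] [InnerProductSpace ℝ H]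
  [MeasurableSpace H]

/-- The set `Γ(μ, ν)` of couplings (transport plans) with marginals `μ` and `ν`. -/
def couplings (μ ν : P2 H) : Set (Measure (H × H)) :=
  {γ | γ.map Prod.fst = μ.toMeasure ∧ γ.map Prod.snd = ν.toMeasure}

/-- The `L²`-Kantorovich-Wasserstein distance. -/
noncomputable def w2 (μ ν : P2 H) : ℝ :=
  Real.sqrt (sInf ((fun γ : Measure (H × H) => ∫ p, ‖p.1 - p.2‖ ^ 2 ∂γ) '' couplings μ ν))

/-- The maximal correlation pairing `[μ, ν]`. -/
noncomputable def maxCorr (μ ν : P2 H) : ℝ :=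
  sSup ((fun γ : Measure (H × H) => ∫ p, inner ℝ p.1 p.2 ∂γ) '' couplings μ ν)

/-- The topology of the Wasserstein metric: a set is open iff it contains a `w2`-ball around
each of its points. -/
instance instTopologicalSpace : TopologicalSpace (P2 H) where
  IsOpen U := ∀ μ ∈ U, ∃ ε > 0, ∀ ν : P2 H, w2 μ ν < ε → ν ∈ U
  isOpen_univ := fun _ _ => ⟨1, one_pos, fun _ _ => Set.mem_univ _⟩
  isOpen_inter := by
    rintro U V hU hV μ ⟨hμU, hμV⟩
    obtain ⟨ε, hε, h⟩ := hU μ hμU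
    obtain ⟨δ, hδ, h'⟩ := hV μ hμV
    exact ⟨min ε δ, lt_min hε hδ, fun ν hν =>
      ⟨h ν (hν.trans_le (min_le_left _ _)), h' ν (hν.trans_le (min_le_right _ _))⟩⟩
  isOpen_sUnion := by
    rintro S hS μ ⟨U, hUS, hμU⟩
    obtain ⟨ε, hε, h⟩ := hS U hUS μ hμU
    exact ⟨ε, hε, fun ν hν => ⟨U, hUS, h ν hν⟩⟩

/-- The interpolation `μ_t = ((1 - t) π¹ + t π²)_♯ γ` of a coupling `γ`. -/
noncomputable def interp [BorelSpace H] [SecondCountableTopology H] (γ : P2 (H × H)) (t : ℝ) :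
    P2 H :=
  map ((1 - t) • ContinuousLinearMap.fst ℝ H H + t • ContinuousLinearMap.snd ℝ H H) γ

/-- Total convexity: convexity along interpolations of arbitrary (not necessarily optimal)
couplings. Products in `EReal` follow the convention `0 * ⊤ = 0`. -/
def IsTotallyConvex [BorelSpace H] [SecondCountableTopology H] (φ : P2 H → EReal) : Prop :=
  ∀ (γ : P2 (H × H)) (t : ℝ), 0 ≤ t → t ≤ 1 →
    φ (interp γ t) ≤ ((1 - t : ℝ) : EReal) * φ (interp γ 0) + (t : EReal) * φ (interp γ 1)

/-- The Kantorovich-Legendre-Fenchel conjugate `φ^⋆(ν) = sup_μ [ν, μ] - φ(μ)`. -/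
noncomputable def klf (φ : P2 H → EReal) (ν : P2 H) : EReal :=
  ⨆ μ : P2 H, (maxCorr ν μ : EReal) - φ μ

/-- The law map `ι(X) = X_♯ P` from `L²(Q, P; H)` to `P2 H`. -/
noncomputable def law [BorelSpace H] [SecondCountableTopology H]
    {Q : Type*} [MeasurableSpace Q] (P : Measure Q) [IsProbabilityMeasure P]
    (X : Lp H 2 P) : P2 H where
  toMeasure := P.map X
  isProbabilityMeasure :=
    Measure.isProbabilityMeasure_map (Lp.aestronglyMeasurable X).aemeasurable
  memLp_id := by
    rw [memLp_map_measure_iff continuous_id.aestronglyMeasurable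
      (Lp.aestronglyMeasurable X).aemeasurable]
    exact Lp.memLp X

end Hilbert

end P2

/-- A proper function with values in `ℝ ∪ {∞}`: it never takes the value `-∞` and is not
identically `+∞`. -/
def IsProperFun {α : Type*} (φ : α → EReal) : Prop :=
  (∀ x, φ x ≠ ⊥) ∧ ∃ x, φ x ≠ ⊤

/-- Convexity of an extended-real-valued function on a real vector space. -/
def IsConvexFun {V : Type*} [AddCommGroup V] [Module ℝ V] (Φ : V → EReal) : Prop :=
  ∀ (X Y : V) (t : ℝ), 0 ≤ t → t ≤ 1 →
    Φ ((1 - t) • X + t • Y) ≤ ((1 - t : ℝ) : EReal) * Φ X + (t : EReal) * Φ Y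

/-! The problem lives in the Hilbert space `Lp H 2 P`, where `φ ∘ law` is a function that depends on
the law alone. Since `P` is atomless, every measure on `H × H` with finite quadratic moment is a
joint law, so total convexity of `φ` is ordinary convexity of `φ ∘ law`.

For a fixed `X`, a coupling of its law with `ν` need not be the law of a pair `(X, Y)`: if `X` is
injective, `Y` is a function of `X`. It is, however, the law of some `(X', Y)` with `X'` arbitrarily
close to `X` (`exists_jointLaw_eq_norm_sub_le`): cut `Q` into countably many cells on which `X` is
nearly constant and transport mass cell by cell. Consequently `maxCorr (law P X) ν` is the supremum
of `inner ℝ X Y` over all `Y` of law `ν`, and a Wasserstein ball around `law P X` lifts to an `L²`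
ball around `X`, which transfers lower semicontinuity.

Fenchel-Moreau gives affine minorants `⟨Y, ·⟩ - b` of `φ ∘ law`. By law invariance each improves to
`[law Y, ·] - b ≤ φ`, whence `φ = φ^⋆⋆`. Conversely, correlations are suprema of continuous linear
functionals, so suprema as in statement 4 are convex and lower semicontinuous on `L²`. -/

/-- The distribution function of an atomless probability measure on `ℝ` is continuous. -/
theorem continuous_cdf_of_nullSingletonClass (ν : Measure ℝ) [IsProbabilityMeasure ν]
    [NullSingletonClass ν] : Continuous (ProbabilityTheory.cdf ν) := by
  refine continuous_iff_continuousAt.2 fun x => ?_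
  rw [(ProbabilityTheory.monotone_cdf ν).continuousAt_iff_leftLim_eq_rightLim,
    StieltjesFunction.rightLim_eq]
  have h := StieltjesFunction.measure_singleton (ProbabilityTheory.cdf ν) x
  rw [ProbabilityTheory.measure_cdf, measure_singleton, eq_comm, ENNReal.ofReal_eq_zero] at h
  exact le_antisymm ((ProbabilityTheory.monotone_cdf ν).leftLim_le le_rfl) (by linarith)

/-- Every atomless probability measure on `ℝ` is pushed forward to the uniform measure on the
unit interval by its distribution function. -/
theorem exists_measurable_map_eq_volume_of_real (ν : Measure ℝ) [IsProbabilityMeasure ν]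
    [NullSingletonClass ν] :
    ∃ T : ℝ → unitInterval, Measurable T ∧ ν.map T = volume := by
  set F := ProbabilityTheory.cdf ν with hF
  have hcont : Continuous F := continuous_cdf_of_nullSingletonClass ν
  have hmono : Monotone F := ProbabilityTheory.monotone_cdf ν
  let T : ℝ → unitInterval := fun x =>
    ⟨F x, ProbabilityTheory.cdf_nonneg ν x, ProbabilityTheory.cdf_le_one ν x⟩
  have hT : Measurable T := hcont.measurable.subtype_mk
  have hsurj : ∀ v : ℝ, 0 < v → v < 1 → ∃ y, F y = v := fun v h0 h1 =>
    mem_range_of_exists_le_of_exists_ge hcont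
      (((ProbabilityTheory.tendsto_cdf_atBot ν).eventually (gt_mem_nhds h0)).exists.imp
        fun _ h => le_of_lt h)
      (((ProbabilityTheory.tendsto_cdf_atTop ν).eventually (lt_mem_nhds h1)).exists.imp
        fun _ h => le_of_lt h)
  have := Measure.isProbabilityMeasure_map (μ := ν) hT.aemeasurable
  refine ⟨T, hT, Measure.ext_of_Iic _ _ fun u => ?_⟩
  rw [Measure.map_apply hT measurableSet_Iic, unitInterval.volume_Iic]
  -- The values 0 and 1 may not be attained by `F`, so `u` is approached by levels `v = F y`
  -- strictly between them.
  have hle : ∀ v : ℝ, u < v → ν (T ⁻¹' Set.Iic u) ≤ ENNReal.ofReal v := by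
    intro v hv
    by_cases h1 : v < 1
    · obtain ⟨y, hy⟩ := hsurj v (u.2.1.trans_lt hv) h1
      rw [← hy, hF, ProbabilityTheory.ofReal_cdf]
      refine measure_mono fun x hx => Set.mem_Iic.2 (not_lt.1 fun hxy => ?_)
      have h2 : F x ≤ u := hx
      have := hmono hxy.le
      linarith
    · exact prob_le_one.trans (ENNReal.one_le_ofReal.2 (not_lt.1 h1))
  have hge : ∀ v : ℝ, v < u → ENNReal.ofReal v ≤ ν (T ⁻¹' Set.Iic u) := by
    intro v hv
    by_cases h0 : 0 < v
    · obtain ⟨y, hy⟩ := hsurj v h0 (hv.trans_le u.2.2)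
      rw [← hy, hF, ProbabilityTheory.ofReal_cdf]
      refine measure_mono fun x hx => ?_
      have h2 := hmono (show x ≤ y from hx)
      exact show F x ≤ u by linarith
    · simp [ENNReal.ofReal_eq_zero.2 (not_lt.1 h0)]
  have hne : ν (T ⁻¹' Set.Iic u) ≠ ∞ := measure_ne_top _ _
  rw [← ENNReal.ofReal_toReal hne]
  congr 1
  refine le_antisymm (le_of_forall_gt_imp_ge_of_dense fun v hv => ?_)
    (le_of_forall_lt_imp_le_of_dense fun v hv => ?_)
  · exact ENNReal.toReal_le_of_le_ofReal (u.2.1.trans hv.le) (hle v hv)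
  · exact (ENNReal.ofReal_le_iff_le_toReal hne).1 (hge v hv)

/-! ### Transport from atomless standard Borel spaces -/

section Realization

variable {Q : Type*} [MeasurableSpace Q] [StandardBorelSpace Q]
  {E : Type*} [MeasurableSpace E] [StandardBorelSpace E] [Nonempty E]

/-- Every law on a standard Borel space is realized on an atomless standard Borel space. -/
theorem exists_measurable_map_eq_of_nullSingletonClass (P : Measure Q) [IsProbabilityMeasure P]
    [NullSingletonClass P] (σ : Measure E) [IsProbabilityMeasure σ] :
    ∃ Z : Q → E, Measurable Z ∧ P.map Z = σ := by
  have hm := measurableEmbedding_embeddingReal Q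
  set ν := P.map (embeddingReal Q)
  have : IsProbabilityMeasure ν := Measure.isProbabilityMeasure_map hm.measurable.aemeasurable
  have : NullSingletonClass ν := ⟨fun x => by
    rw [hm.map_apply]
    exact (Set.subsingleton_singleton.preimage hm.injective).measure_zero P⟩
  obtain ⟨T, hT, hTν⟩ := exists_measurable_map_eq_volume_of_real ν
  obtain ⟨f, hf, hfσ⟩ := σ.exists_measurable_map_eq
  refine ⟨f ∘ T ∘ embeddingReal Q, hf.comp (hT.comp hm.measurable), ?_⟩
  rw [← Measure.map_map hf (hT.comp hm.measurable), ← Measure.map_map hT hm.measurable, hTν, hfσ]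

/-- Finite measures of equal mass on standard Borel spaces, the first one atomless, are related
by a transport map. -/
theorem exists_measurable_map_eq_of_measure_univ_eq (P : Measure Q) [IsFiniteMeasure P]
    [NullSingletonClass P] (σ : Measure E) (h : P Set.univ = σ Set.univ) :
    ∃ Z : Q → E, Measurable Z ∧ P.map Z = σ := by
  rcases eq_or_ne P 0 with rfl | hP
  · have hσ : σ = 0 := Measure.measure_univ_eq_zero.1 (by simpa using h.symm)
    exact ⟨fun _ => Classical.arbitrary E, measurable_const, by simp [hσ]⟩
  have h0 : P Set.univ ≠ 0 := by simpa using hP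
  have ht : P Set.univ ≠ ∞ := measure_ne_top _ _
  have : NeZero P := ⟨hP⟩
  have : IsProbabilityMeasure ((P Set.univ)⁻¹ • σ) :=
    ⟨by simp [← h, ENNReal.inv_mul_cancel h0 ht]⟩
  have : NullSingletonClass ((P Set.univ)⁻¹ • P) := ⟨fun x => by simp⟩
  obtain ⟨Z, hZ, hmap⟩ := exists_measurable_map_eq_of_nullSingletonClass
    ((P Set.univ)⁻¹ • P) ((P Set.univ)⁻¹ • σ)
  refine ⟨Z, hZ, ?_⟩
  rw [Measure.map_smul] at hmap
  have := congrArg (fun m => P Set.univ • m) hmap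
  simpa [smul_smul, ENNReal.mul_inv_cancel h0 ht] using this

/-- If `q` and `Y` have the same law under `σ` and `P`, with `P` atomless, then `σ` is the law of
some `Z` such that `q ∘ Z` is uniformly close to `Y`. -/
theorem exists_measurable_map_eq_dist_lt {M : Type*} [PseudoMetricSpace M]
    [SecondCountableTopology M] [MeasurableSpace M] [BorelSpace M]
    (P : Measure Q) [IsFiniteMeasure P] [NullSingletonClass P] (σ : Measure E)
    {q : E → M} (hq : Measurable q) {Y : Q → M} (hY : Measurable Y) (h : σ.map q = P.map Y)
    {ε : ℝ} (hε : 0 < ε) :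
    ∃ Z : Q → E, Measurable Z ∧ P.map Z = σ ∧ ∀ᵐ ω ∂P, dist (q (Z ω)) (Y ω) < ε := by
  classical
  have : Nonempty M := ⟨q (Classical.arbitrary E)⟩
  have hex : ∀ y : M, ∃ n, dist y (TopologicalSpace.denseSeq M n) < ε / 2 := fun y =>
    (TopologicalSpace.denseRange_denseSeq M).exists_dist_lt y (by positivity)
  let idx : M → ℕ := fun y => Nat.find (hex y)
  have hidx : Measurable idx := measurable_find hex fun n =>
    measurableSet_lt (measurable_id.dist measurable_const) measurable_const
  have hspec : ∀ y, dist y (TopologicalSpace.denseSeq M (idx y)) < ε / 2 :=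
    fun y => Nat.find_spec (hex y)
  -- Cells on which `Y`, respectively `q`, stays within `ε / 2` of one point of a dense sequence.
  -- Equality of the two laws makes corresponding cells equal in mass, so each `A n` can be
  -- transported onto `B n`.
  let A : ℕ → Set Q := fun n => (fun ω => idx (Y ω)) ⁻¹' {n}
  let B : ℕ → Set E := fun n => (fun z => idx (q z)) ⁻¹' {n}
  have hA : ∀ n, MeasurableSet (A n) := fun n => (hidx.comp hY) (measurableSet_singleton n)
  have hB : ∀ n, MeasurableSet (B n) := fun n => (hidx.comp hq) (measurableSet_singleton n)
  have hAB : ∀ n, P.restrict (A n) Set.univ = σ.restrict (B n) Set.univ := fun n => by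
    have := congrArg (fun m => m (idx ⁻¹' {n})) h
    rw [Measure.map_apply hq (hidx (measurableSet_singleton n)),
      Measure.map_apply hY (hidx (measurableSet_singleton n))] at this
    rw [Measure.restrict_apply_univ, Measure.restrict_apply_univ]
    exact this.symm
  choose Z hZ hmap using fun n => exists_measurable_map_eq_of_measure_univ_eq
    (P.restrict (A n)) (σ.restrict (B n)) (hAB n)
  have hAd : Pairwise (Function.onFun Disjoint A) := fun i j hij =>
    (Set.disjoint_singleton.2 hij).preimage _
  have hBd : Pairwise (Function.onFun Disjoint B) := fun i j hij =>
    (Set.disjoint_singleton.2 hij).preimage _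
  have hAu : ⋃ n, A n = Set.univ := Set.eq_univ_of_forall fun ω => Set.mem_iUnion.2 ⟨_, rfl⟩
  have hBu : ⋃ n, B n = Set.univ := Set.eq_univ_of_forall fun ω => Set.mem_iUnion.2 ⟨_, rfl⟩
  have hP : P = Measure.sum fun n => P.restrict (A n) := by
    rw [← Measure.restrict_iUnion hAd hA, hAu, Measure.restrict_univ]
  have hσ : σ = Measure.sum fun n => σ.restrict (B n) := by
    rw [← Measure.restrict_iUnion hBd hB, hBu, Measure.restrict_univ]
  let W : Q → E := fun ω => Z (idx (Y ω)) ω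
  have hW : Measurable W :=
    (measurable_from_prod_countable_right (f := fun p : ℕ × Q => Z p.1 p.2) hZ).comp
      ((hidx.comp hY).prodMk measurable_id)
  have hWZ : ∀ n, ∀ᵐ ω ∂P.restrict (A n), W ω = Z n ω ∧ ω ∈ A n := fun n => by
    filter_upwards [ae_restrict_mem (hA n)] with ω hω
    have : idx (Y ω) = n := hω
    exact ⟨by simp only [W, this], hω⟩
  refine ⟨W, hW, ?_, ?_⟩
  · conv_lhs => rw [hP]
    conv_rhs => rw [hσ]
    rw [Measure.map_sum hW.aemeasurable]
    congr 1
    funext n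
    rw [← hmap n]
    exact Measure.map_congr ((hWZ n).mono fun _ h => h.1)
  · rw [hP, Measure.ae_sum_iff]
    intro n
    have h1 : ∀ᵐ ω ∂P.restrict (A n), Z n ω ∈ B n := by
      refine ae_of_ae_map (hZ n).aemeasurable ?_
      rw [hmap n]
      exact ae_restrict_mem (hB n)
    filter_upwards [h1, hWZ n] with ω h1 ⟨h2, h3⟩
    have e1 : idx (q (Z n ω)) = n := h1
    have e2 : idx (Y ω) = n := h3
    have d1 := hspec (q (Z n ω))
    have d2 := hspec (Y ω)
    rw [e1] at d1
    rw [e2] at d2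
    rw [h2]
    linarith [dist_triangle_right (q (Z n ω)) (Y ω) (TopologicalSpace.denseSeq M n)]

end Realization

/-! ### Fenchel-Moreau: affine minorants of convex functions -/

section FenchelMoreau

theorem EReal.exists_coe_of_ne {x : EReal} (h1 : x ≠ ⊥) (h2 : x ≠ ⊤) : ∃ r : ℝ, x = r :=
  ⟨x.toReal, (EReal.coe_toReal h2 h1).symm⟩

theorem EReal.coe_le_of_forall_le_coe {a : ℝ} {x : EReal} (hx : x ≠ ⊥)
    (h : ∀ s : ℝ, x ≤ s → a ≤ s) : (a : EReal) ≤ x := by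
  rcases eq_or_ne x ⊤ with rfl | hx'
  · exact le_top
  · obtain ⟨r, rfl⟩ := EReal.exists_coe_of_ne hx hx'
    exact EReal.coe_le_coe_iff.2 (h r le_rfl)

theorem IsConvexFun.convex_epigraph {V : Type*} [AddCommGroup V] [Module ℝ V] {Φ : V → EReal}
    (h : IsConvexFun Φ) : Convex ℝ {p : V × ℝ | Φ p.1 ≤ p.2} := by
  rintro ⟨x, r⟩ hx ⟨y, s⟩ hy a b ha hb hab
  simp only [Set.mem_ofPred_eq] at hx hy
  obtain rfl : a = 1 - b := by linarith
  refine (h x y b hb (by linarith)).trans ?_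
  have h1 := mul_le_mul_of_nonneg_left hx (EReal.coe_nonneg.2 ha)
  have h2 := mul_le_mul_of_nonneg_left hy (EReal.coe_nonneg.2 hb)
  refine (add_le_add h1 h2).trans (le_of_eq ?_)
  simp

theorem LowerSemicontinuous.isClosed_real_epigraph {V : Type*} [TopologicalSpace V]
    {Φ : V → EReal} (h : LowerSemicontinuous Φ) : IsClosed {p : V × ℝ | Φ p.1 ≤ p.2} :=
  h.isClosed_epigraph.preimage
    (continuous_fst.prodMk (continuous_coe_real_ereal.comp continuous_snd))

variable {V : Type*} [NormedAddCommGroup V] [NormedSpace ℝ V]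

/-- Separation of a point below the graph of a convex lower semicontinuous function from its
epigraph. -/
theorem IsConvexFun.exists_separation {Φ : V → EReal} (hc : IsConvexFun Φ)
    (hl : LowerSemicontinuous Φ) (hΦ : IsProperFun Φ) {x : V} {a : ℝ} (hx : a < Φ x) :
    ∃ (g : StrongDual ℝ V) (c u : ℝ), c ≤ 0 ∧ (∀ z, ∀ s : ℝ, Φ z ≤ s → g z + c * s < u) ∧
      u < g x + c * a := by
  obtain ⟨f, u, h1, h2⟩ := geometric_hahn_banach_closed_point hc.convex_epigraph
    hl.isClosed_real_epigraph (x := (x, a)) (by simpa using hx)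
  have hf : ∀ z s, f (z, s) = f.comp (ContinuousLinearMap.inl ℝ V ℝ) z + f (0, 1) * s := by
    intro z s
    have : (z, s) = (z, (0 : ℝ)) + s • ((0 : V), (1 : ℝ)) := by simp
    rw [this, map_add, map_smul]
    simp [mul_comm]
  have h3 : ∀ z, ∀ s : ℝ, Φ z ≤ s →
      f.comp (ContinuousLinearMap.inl ℝ V ℝ) z + f (0, 1) * s < u := fun z s hs => by
    rw [← hf]; exact h1 (z, s) hs
  refine ⟨f.comp (ContinuousLinearMap.inl ℝ V ℝ), f (0, 1), u, ?_, h3, by rwa [← hf]⟩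
  obtain ⟨x₀, hx₀⟩ := hΦ.2
  obtain ⟨r, hr⟩ := EReal.exists_coe_of_ne (hΦ.1 x₀) hx₀
  by_contra! hpos
  set c := f (0, 1)
  set g := f.comp (ContinuousLinearMap.inl ℝ V ℝ)
  -- The epigraph contains the whole vertical ray above `(x₀, r)`; a positive `c` would make the
  -- functional exceed `u` on it.
  have h4 := h3 x₀ (max r ((u - g x₀) / c)) (by rw [hr]; exact_mod_cast le_max_left _ _)
  have h5 : (u - g x₀) ≤ c * max r ((u - g x₀) / c) := by
    calc u - g x₀ = c * ((u - g x₀) / c) := by field_simp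
      _ ≤ _ := by gcongr; exact le_max_right _ _
  linarith

/-- A hyperplane with `c < 0` is not vertical: solving `g z + c * s = u` for `s` presents it as the
graph of an affine function. -/
theorem exists_affine_minorant_of_separation {Φ : V → EReal} (hbot : ∀ z, Φ z ≠ ⊥) {x : V}
    {a : ℝ} {g : StrongDual ℝ V} {c u : ℝ} (hc : c < 0)
    (h : ∀ z, ∀ s : ℝ, Φ z ≤ s → g z + c * s < u) (hx : u < g x + c * a) :
    ∃ (y : StrongDual ℝ V) (b : ℝ), (∀ z, ((y z - b : ℝ) : EReal) ≤ Φ z) ∧ a < y x - b := by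
  have key : ∀ z, ((-c)⁻¹ • g) z - (-c)⁻¹ * u = (g z - u) / (-c) := fun z => by
    simp only [_root_.smul_apply, smul_eq_mul]; ring
  refine ⟨(-c)⁻¹ • g, (-c)⁻¹ * u, fun z => ?_, ?_⟩
  · refine EReal.coe_le_of_forall_le_coe (hbot z) fun s hs => ?_
    rw [key, div_le_iff₀ (by linarith)]
    linarith [h z s hs]
  · rw [key, lt_div_iff₀ (by linarith)]
    linarith

/-- A proper convex lower semicontinuous function is the supremum of its continuous affine
minorants. -/
theorem IsConvexFun.exists_affine_minorant {Φ : V → EReal} (hc : IsConvexFun Φ)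
    (hl : LowerSemicontinuous Φ) (hΦ : IsProperFun Φ) {x : V} {a : ℝ} (hx : a < Φ x) :
    ∃ (y : StrongDual ℝ V) (b : ℝ), (∀ z, ((y z - b : ℝ) : EReal) ≤ Φ z) ∧ a < y x - b := by
  obtain ⟨g, c, u, hc0, h1, h2⟩ := hc.exists_separation hl hΦ hx
  rcases hc0.lt_or_eq with hneg | rfl
  · exact exists_affine_minorant_of_separation hΦ.1 hneg h1 h2
  -- Vertical hyperplane: `g - u` is negative on the domain of `Φ` and positive at `x`. Adding a
  -- large multiple of it to any affine minorant keeps a minorant and lifts its value at `x` above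
  -- `a`. Such a minorant comes from separating at `x₀`, where `Φ` is finite and the hyperplane
  -- cannot be vertical.
  obtain ⟨x₀, hx₀⟩ := hΦ.2
  obtain ⟨r, hr⟩ := EReal.exists_coe_of_ne (hΦ.1 x₀) hx₀
  obtain ⟨y₀, b₀, hy₀, -⟩ : ∃ (y : StrongDual ℝ V) (b : ℝ),
      (∀ z, ((y z - b : ℝ) : EReal) ≤ Φ z) ∧ r - 1 < y x₀ - b := by
    have hlt : ((r - 1 : ℝ) : EReal) < Φ x₀ := by
      rw [hr]; exact_mod_cast sub_one_lt r
    obtain ⟨g', c', u', hc', h1', h2'⟩ := hc.exists_separation hl hΦ hlt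
    refine exists_affine_minorant_of_separation hΦ.1 (hc'.lt_of_ne ?_) h1' h2'
    rintro rfl
    have := h1' x₀ r hr.le
    linarith
  simp only [zero_mul, add_zero] at h1 h2
  obtain ⟨n, hn⟩ := exists_nat_gt ((a - (y₀ x - b₀)) / (g x - u))
  rw [div_lt_iff₀ (by linarith)] at hn
  refine ⟨y₀ + (n : ℝ) • g, b₀ + n * u, fun z => ?_, ?_⟩
  · refine EReal.coe_le_of_forall_le_coe (hΦ.1 z) fun s hs => ?_
    have h3 : y₀ z - b₀ ≤ s := EReal.coe_le_coe_iff.1 ((hy₀ z).trans hs)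
    have h4 : (n : ℝ) * (g z - u) ≤ 0 :=
      mul_nonpos_of_nonneg_of_nonpos n.cast_nonneg (by linarith [h1 z s hs])
    simp only [_root_.add_apply, _root_.smul_apply, smul_eq_mul]
    linarith
  · simp only [_root_.add_apply, _root_.smul_apply, smul_eq_mul]
    linarith

end FenchelMoreau

namespace P2

/-! ### Conjugates as suprema of correlations -/

section Conjugate

variable {H : Type*} [NormedAddCommGroup H] [InnerProductSpace ℝ H] [MeasurableSpace H]

/-- A conjugate function is a supremum of correlations minus constants. -/
theorem klf_eq_iSup {ψ : P2 H → EReal} (hψ : ∀ ν, ψ ν ≠ ⊥) (μ : P2 H) :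
    klf ψ μ = ⨆ p ∈ {p : P2 H × ℝ | ψ p.1 ≤ p.2}, ((maxCorr μ p.1 - p.2 : ℝ) : EReal) := by
  refine le_antisymm (iSup_le fun ν => ?_) (iSup₂_le fun p hp => ?_)
  · rcases eq_or_ne (ψ ν) ⊤ with h | h
    · simp [h]
    obtain ⟨r, hr⟩ := EReal.exists_coe_of_ne (hψ ν) h
    rw [hr, ← EReal.coe_sub]
    exact le_iSup₂ (f := fun (p : P2 H × ℝ) (_ : p ∈ {p : P2 H × ℝ | ψ p.1 ≤ p.2}) =>
      ((maxCorr μ p.1 - p.2 : ℝ) : EReal)) (ν, r) hr.le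
  · rw [EReal.coe_sub]
    exact (EReal.sub_le_sub le_rfl hp).trans (le_iSup (fun ν => (maxCorr μ ν : EReal) - ψ ν) p.1)

theorem klf_ne_bot {φ : P2 H → EReal} (hφ : IsProperFun φ) (ν : P2 H) : klf φ ν ≠ ⊥ := by
  obtain ⟨μ, hμ⟩ := hφ.2
  obtain ⟨r, hr⟩ := EReal.exists_coe_of_ne (hφ.1 μ) hμ
  refine ne_bot_of_le_ne_bot ?_ (le_iSup (fun μ => (maxCorr ν μ : EReal) - φ μ) μ)
  simp only [hr, ← EReal.coe_sub]
  exact EReal.coe_ne_bot _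

end Conjugate

/-! ### Random variables, joint laws and the law map -/

section Hilbert

variable {H : Type*} [NormedAddCommGroup H] [InnerProductSpace ℝ H]
  [SecondCountableTopology H] [MeasurableSpace H] [BorelSpace H]
  {Q : Type*} [MeasurableSpace Q] {P : Measure Q} [IsProbabilityMeasure P]

theorem aemeasurable_pair (X Y : Lp H 2 P) : AEMeasurable (fun ω => (X ω, Y ω)) P :=
  (Lp.aestronglyMeasurable X).aemeasurable.prodMk (Lp.aestronglyMeasurable Y).aemeasurable

/-- The joint law of two square integrable random variables. -/
noncomputable def jointLaw (X Y : Lp H 2 P) : P2 (H × H) where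
  toMeasure := P.map fun ω => (X ω, Y ω)
  isProbabilityMeasure := Measure.isProbabilityMeasure_map (aemeasurable_pair X Y)
  memLp_id := by
    rw [memLp_map_measure_iff continuous_id.aestronglyMeasurable (aemeasurable_pair X Y)]
    exact MemLp.of_fst_snd ⟨Lp.memLp X, Lp.memLp Y⟩

theorem jointLaw_mem_couplings (X Y : Lp H 2 P) :
    (jointLaw X Y).toMeasure ∈ couplings (law P X) (law P Y) := by
  constructor
  · exact AEMeasurable.map_map_of_aemeasurable measurable_fst.aemeasurable (aemeasurable_pair X Y)
  · exact AEMeasurable.map_map_of_aemeasurable measurable_snd.aemeasurable (aemeasurable_pair X Y)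

theorem integral_inner_jointLaw (X Y : Lp H 2 P) :
    ∫ p, inner ℝ p.1 p.2 ∂(jointLaw X Y).toMeasure = inner ℝ X Y := by
  rw [L2.inner_def]
  exact integral_map (aemeasurable_pair X Y)
    (continuous_fst.inner continuous_snd).aestronglyMeasurable

theorem integral_norm_sub_sq_jointLaw (X Y : Lp H 2 P) :
    ∫ p, ‖p.1 - p.2‖ ^ 2 ∂(jointLaw X Y).toMeasure = ‖X - Y‖ ^ 2 := by
  rw [← real_inner_self_eq_norm_sq, L2.inner_def]
  refine (integral_map (aemeasurable_pair X Y)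
    ((continuous_fst.sub continuous_snd).norm.pow 2).aestronglyMeasurable).trans ?_
  refine integral_congr_ae ?_
  filter_upwards [Lp.coeFn_sub X Y] with ω hω
  rw [hω, Pi.sub_apply, real_inner_self_eq_norm_sq]
  rfl

/-- The `L²` norm is the quadratic moment of the law. This bounds `‖Y‖` before a particular `Y` of
prescribed law has been chosen. -/
theorem norm_eq_of_law_eq {X Y : Lp H 2 P} (h : law P X = law P Y) : ‖X‖ = ‖Y‖ := by
  have key : ∀ Z : Lp H 2 P, ‖Z‖ = (eLpNorm id 2 (law P Z).toMeasure).toReal := fun Z => by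
    rw [Lp.norm_def]
    exact congrArg _ (eLpNorm_map_measure continuous_id.aestronglyMeasurable
      (Lp.aestronglyMeasurable Z).aemeasurable).symm
  rw [key, key, h]

theorem interp_jointLaw (X Y : Lp H 2 P) (t : ℝ) :
    interp (jointLaw X Y) t = law P ((1 - t) • X + t • Y) := by
  refine P2.ext ?_
  refine (AEMeasurable.map_map_of_aemeasurable (ContinuousLinearMap.continuous
    _).measurable.aemeasurable (aemeasurable_pair X Y)).trans (Measure.map_congr ?_)
  filter_upwards [Lp.coeFn_add ((1 - t) • X) (t • Y), Lp.coeFn_smul (1 - t) X,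
    Lp.coeFn_smul t Y] with ω h1 h2 h3
  rw [h1, Pi.add_apply, h2, h3]
  simp

/-- Square integrable random variables with a prescribed joint law. -/
theorem exists_lp_of_map_eq {μ ν : P2 H} {γ : Measure (H × H)} (hγ : γ ∈ couplings μ ν)
    {Z : Q → H × H} (hZ : Measurable Z) (hmap : P.map Z = γ) :
    ∃ X Y : Lp H 2 P, X =ᵐ[P] (fun ω => (Z ω).1) ∧ Y =ᵐ[P] (fun ω => (Z ω).2) ∧
      law P X = μ ∧ law P Y = ν ∧ (jointLaw X Y).toMeasure = γ := by
  have m1 : P.map (fun ω => (Z ω).1) = μ.toMeasure := by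
    rw [← hγ.1, ← hmap, Measure.map_map measurable_fst hZ]; rfl
  have m2 : P.map (fun ω => (Z ω).2) = ν.toMeasure := by
    rw [← hγ.2, ← hmap, Measure.map_map measurable_snd hZ]; rfl
  have l1 : MemLp (fun ω => (Z ω).1) 2 P :=
    MemLp.comp_of_map (g := id) (by rw [m1]; exact μ.memLp_id) hZ.fst.aemeasurable
  have l2 : MemLp (fun ω => (Z ω).2) 2 P :=
    MemLp.comp_of_map (g := id) (by rw [m2]; exact ν.memLp_id) hZ.snd.aemeasurable
  refine ⟨l1.toLp, l2.toLp, l1.coeFn_toLp, l2.coeFn_toLp, P2.ext ?_, P2.ext ?_, ?_⟩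
  · exact (Measure.map_congr l1.coeFn_toLp).trans m1
  · exact (Measure.map_congr l2.coeFn_toLp).trans m2
  · refine (Measure.map_congr ?_).trans hmap
    filter_upwards [l1.coeFn_toLp, l2.coeFn_toLp] with ω h1 h2
    rw [h1, h2]

theorem w2_law_le (X Y : Lp H 2 P) : w2 (law P X) (law P Y) ≤ ‖X - Y‖ := by
  refine Real.sqrt_le_iff.2 ⟨norm_nonneg _, ?_⟩
  rw [← integral_norm_sub_sq_jointLaw]
  refine csInf_le ⟨0, ?_⟩ ⟨_, jointLaw_mem_couplings X Y, rfl⟩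
  rintro _ ⟨γ, -, rfl⟩
  exact integral_nonneg fun p => sq_nonneg _

variable (P) in
theorem continuous_law : Continuous (fun X : Lp H 2 P => law P X) := by
  refine continuous_def.2 fun U hU => Metric.isOpen_iff.2 fun X hX => ?_
  obtain ⟨ε, hε, h⟩ := hU _ hX
  refine ⟨ε, hε, fun Y hY => h _ ((w2_law_le X Y).trans_lt ?_)⟩
  rwa [← dist_eq_norm, dist_comm]

/-! ### Lifting couplings, correlations and convexity to `L²` -/

section Standard

variable [CompleteSpace H] [StandardBorelSpace Q] [NullSingletonClass P]

theorem exists_jointLaw_eq (γ : P2 (H × H)) : ∃ X Y : Lp H 2 P, jointLaw X Y = γ := by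
  have := γ.isProbabilityMeasure
  obtain ⟨Z, hZ, hmap⟩ := exists_measurable_map_eq_of_nullSingletonClass P γ.toMeasure
  obtain ⟨X, Y, -, -, -, -, h⟩ := exists_lp_of_map_eq
    (μ := map (ContinuousLinearMap.fst ℝ H H) γ) (ν := map (ContinuousLinearMap.snd ℝ H H) γ)
    ⟨rfl, rfl⟩ hZ hmap
  exact ⟨X, Y, P2.ext h⟩

variable (P) in
theorem exists_law_eq (μ : P2 H) : ∃ X : Lp H 2 P, law P X = μ := by
  have := μ.isProbabilityMeasure
  obtain ⟨Z, hZ, hmap⟩ := exists_measurable_map_eq_of_nullSingletonClass P μ.toMeasure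
  have l : MemLp Z 2 P :=
    MemLp.comp_of_map (g := id) (by rw [hmap]; exact μ.memLp_id) hZ.aemeasurable
  exact ⟨l.toLp, P2.ext ((Measure.map_congr l.coeFn_toLp).trans hmap)⟩

/-- Any coupling of the law of `X` with `ν` is the joint law of two random variables, the first of
which is arbitrarily close to `X`. -/
theorem exists_jointLaw_eq_norm_sub_le (X : Lp H 2 P) {ν : P2 H} {γ : Measure (H × H)}
    (hγ : γ ∈ couplings (law P X) ν) {ε : ℝ} (hε : 0 < ε) :
    ∃ X' Y : Lp H 2 P, law P X' = law P X ∧ law P Y = ν ∧ (jointLaw X' Y).toMeasure = γ ∧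
      ‖X' - X‖ ≤ ε := by
  have hX := (Lp.aestronglyMeasurable X).aemeasurable
  -- The cell construction needs a measurable function, so `X` is replaced by a measurable version.
  have hq : γ.map Prod.fst = P.map (hX.mk X) := hγ.1.trans (Measure.map_congr hX.ae_eq_mk)
  obtain ⟨Z, hZ, hmap, hdist⟩ :=
    exists_measurable_map_eq_dist_lt P γ measurable_fst hX.measurable_mk hq hε
  obtain ⟨X', Y, h1, -, h3, h4, h5⟩ := exists_lp_of_map_eq hγ hZ hmap
  refine ⟨X', Y, h3, h4, h5, ?_⟩
  have := Lp.norm_le_of_ae_bound (f := X' - X) hε.le (by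
    filter_upwards [Lp.coeFn_sub X' X, hdist, h1, hX.ae_eq_mk] with ω e1 e2 e3 e4
    rw [e1, Pi.sub_apply, e3, e4, ← dist_eq_norm]
    exact e2.le)
  simpa [measureUnivNNReal] using this

/-- Together with the bound below, this rules out the default value 0 of the real `sSup` in
`maxCorr`. -/
theorem couplings_nonempty (X : Lp H 2 P) (ν : P2 H) : (couplings (law P X) ν).Nonempty := by
  obtain ⟨Y, rfl⟩ := exists_law_eq P ν
  exact ⟨_, jointLaw_mem_couplings X Y⟩

/-- Cauchy-Schwarz in `L²`, since every coupling is a joint law. -/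
theorem bddAbove_integral_inner (X : Lp H 2 P) (ν : P2 H) :
    BddAbove ((fun γ : Measure (H × H) => ∫ p, inner ℝ p.1 p.2 ∂γ) '' couplings (law P X) ν) := by
  obtain ⟨Y, rfl⟩ := exists_law_eq P ν
  refine ⟨‖X‖ * ‖Y‖, ?_⟩
  rintro _ ⟨γ, hγ, rfl⟩
  obtain ⟨X', Y', h1, h2, rfl, -⟩ := exists_jointLaw_eq_norm_sub_le X hγ one_pos
  rw [← norm_eq_of_law_eq h1, ← norm_eq_of_law_eq h2]
  exact (integral_inner_jointLaw X' Y').trans_le (real_inner_le_norm _ _)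

theorem inner_le_maxCorr (X Y : Lp H 2 P) : inner ℝ X Y ≤ maxCorr (law P X) (law P Y) := by
  rw [← integral_inner_jointLaw]
  exact le_csSup (bddAbove_integral_inner X _) ⟨_, jointLaw_mem_couplings X Y, rfl⟩

/-- The correlation of `law P X` and `ν` is approximated by scalar products with `X` itself. -/
theorem exists_lt_inner (X : Lp H 2 P) {ν : P2 H} {a : ℝ} (ha : a < maxCorr (law P X) ν) :
    ∃ Y : Lp H 2 P, law P Y = ν ∧ a < inner ℝ X Y := by
  obtain ⟨_, ⟨γ, hγ, rfl⟩, hlt⟩ := exists_lt_of_lt_csSup ((couplings_nonempty X ν).image _) ha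
  obtain ⟨Y₀, hY₀⟩ := exists_law_eq P ν
  set d := (∫ p, inner ℝ p.1 p.2 ∂γ) - a with hd
  have hd0 : 0 < d := sub_pos.2 hlt
  -- Replacing `X'` by `X` costs at most `‖X' - X‖ * ‖Y‖`, and `‖Y‖ = ‖Y₀‖` is known in advance. The
  -- `+ 1` keeps the divisor positive and the loss strictly below `d`.
  obtain ⟨X', Y, h1, h2, rfl, h4⟩ := exists_jointLaw_eq_norm_sub_le X hγ
    (ε := d / (‖Y₀‖ + 1)) (by positivity)
  refine ⟨Y, h2, ?_⟩
  rw [integral_inner_jointLaw] at hd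
  have h5 : inner ℝ (X' - X) Y ≤ d / (‖Y₀‖ + 1) * ‖Y₀‖ := by
    rw [← norm_eq_of_law_eq (h2.trans hY₀.symm)]
    rw [← norm_eq_of_law_eq (h2.trans hY₀.symm)] at h4
    exact (real_inner_le_norm _ _).trans (by gcongr)
  have h6 : d / (‖Y₀‖ + 1) * ‖Y₀‖ < d := by
    rw [div_mul_eq_mul_div, div_lt_iff₀ (by positivity)]
    nlinarith
  rw [inner_sub_left] at h5
  linarith

theorem maxCorr_comm (P : Measure Q) [IsProbabilityMeasure P] [NullSingletonClass P]
    (μ ν : P2 H) : maxCorr μ ν = maxCorr ν μ := by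
  have key : ∀ μ ν : P2 H, maxCorr μ ν ≤ maxCorr ν μ := fun μ ν => by
    obtain ⟨X, rfl⟩ := exists_law_eq P μ
    refine le_of_forall_lt fun a ha => ?_
    obtain ⟨Y, rfl, hY⟩ := exists_lt_inner X ha
    rw [real_inner_comm] at hY
    exact hY.trans_le (inner_le_maxCorr Y X)
  exact le_antisymm (key μ ν) (key ν μ)

/-- An almost optimal coupling is realized with first variable `X'` near `X`; half of the slack `ε -
r` pays for the exchange. This makes the law map open, as needed to descend lower semicontinuity. -/
theorem exists_norm_sub_lt_of_w2_lt (X : Lp H 2 P) {ν : P2 H} {ε : ℝ}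
    (h : w2 (law P X) ν < ε) : ∃ Y : Lp H 2 P, law P Y = ν ∧ ‖X - Y‖ < ε := by
  have hε : 0 < ε := (Real.sqrt_nonneg _).trans_lt h
  obtain ⟨_, ⟨γ, hγ, rfl⟩, hlt⟩ :=
    exists_lt_of_csInf_lt ((couplings_nonempty X ν).image _) ((Real.sqrt_lt' hε).1 h)
  set r := Real.sqrt (∫ p, ‖p.1 - p.2‖ ^ 2 ∂γ) with hr
  have hrε : r < ε := (Real.sqrt_lt' hε).2 hlt
  obtain ⟨X', Y, -, h2, rfl, h4⟩ := exists_jointLaw_eq_norm_sub_le X hγ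
    (ε := (ε - r) / 2) (by linarith)
  rw [integral_norm_sub_sq_jointLaw, Real.sqrt_sq (norm_nonneg _)] at hr
  refine ⟨Y, h2, ?_⟩
  have := norm_sub_le_norm_sub_add_norm_sub X X' Y
  rw [norm_sub_rev X X'] at this
  linarith

theorem lowerSemicontinuous_comp_law_iff {φ : P2 H → EReal} :
    LowerSemicontinuous (fun X : Lp H 2 P => φ (law P X)) ↔ LowerSemicontinuous φ := by
  refine ⟨fun h => ?_, fun h => h.comp (continuous_law P)⟩
  refine lowerSemicontinuous_iff_isOpen_preimage.2 fun a μ hμ => ?_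
  obtain ⟨X, rfl⟩ := exists_law_eq P μ
  obtain ⟨ε, hε, hball⟩ := Metric.eventually_nhds_iff.1 (h X a hμ)
  refine ⟨ε, hε, fun ν hν => ?_⟩
  obtain ⟨Y, rfl, hY⟩ := exists_norm_sub_lt_of_w2_lt X hν
  exact hball (by rwa [dist_comm, dist_eq_norm])

variable (P) in
theorem isConvexFun_comp_law_iff {φ : P2 H → EReal} :
    IsConvexFun (fun X : Lp H 2 P => φ (law P X)) ↔ IsTotallyConvex φ := by
  have e0 : ∀ X Y : Lp H 2 P, interp (jointLaw X Y) 0 = law P X := fun X Y => by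
    rw [interp_jointLaw]; simp
  have e1 : ∀ X Y : Lp H 2 P, interp (jointLaw X Y) 1 = law P Y := fun X Y => by
    rw [interp_jointLaw]; simp
  constructor
  · intro h γ t h0 h1
    obtain ⟨X, Y, rfl⟩ := exists_jointLaw_eq (P := P) γ
    rw [e0, e1, interp_jointLaw]
    exact h X Y t h0 h1
  · intro h X Y t h0 h1
    have := h (jointLaw X Y) t h0 h1
    rwa [e0, e1, interp_jointLaw] at this

/-- By `exists_lt_inner`, a correlation is a supremum of linear functionals `⟨·, Z⟩` over `Z` of law
`ν`. -/
theorem maxCorr_law_convex (ν : P2 H) (X Y : Lp H 2 P) {t : ℝ} (h0 : 0 ≤ t) (h1 : t ≤ 1) :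
    maxCorr (law P ((1 - t) • X + t • Y)) ν ≤
      (1 - t) * maxCorr (law P X) ν + t * maxCorr (law P Y) ν := by
  refine le_of_forall_lt_imp_le_of_dense fun a ha => ?_
  obtain ⟨Z, rfl, hZ⟩ := exists_lt_inner _ ha
  rw [inner_add_left, real_inner_smul_left, real_inner_smul_left] at hZ
  refine hZ.le.trans (add_le_add ?_ ?_)
  · exact mul_le_mul_of_nonneg_left (inner_le_maxCorr X Z) (sub_nonneg.2 h1)
  · exact mul_le_mul_of_nonneg_left (inner_le_maxCorr Y Z) h0

theorem lowerSemicontinuous_maxCorr_law (ν : P2 H) :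
    LowerSemicontinuous (fun X : Lp H 2 P => maxCorr (law P X) ν) := by
  intro X a ha
  obtain ⟨Y, rfl, hY⟩ := exists_lt_inner X ha
  have hcont : Continuous (fun X' : Lp H 2 P => inner ℝ X' Y) := continuous_id.inner continuous_const
  filter_upwards [hcont.continuousAt.eventually (lt_mem_nhds hY)] with X' hX'
  exact hX'.trans_le (inner_le_maxCorr X' Y)

theorem lowerSemicontinuous_of_eq_iSup {φ : P2 H → EReal} {G : Set (P2 H × ℝ)}
    (hG : ∀ μ, φ μ = ⨆ p ∈ G, ((maxCorr μ p.1 - p.2 : ℝ) : EReal)) :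
    LowerSemicontinuous (fun X : Lp H 2 P => φ (law P X)) := by
  simp only [hG]
  refine lowerSemicontinuous_biSup fun p _ => ?_
  have h : Continuous (fun s : ℝ => ((s - p.2 : ℝ) : EReal)) :=
    continuous_coe_real_ereal.comp (continuous_id.sub continuous_const)
  exact h.comp_lowerSemicontinuous (lowerSemicontinuous_maxCorr_law p.1)
    fun s t hst => EReal.coe_le_coe_iff.2 (sub_le_sub_right hst _)

theorem isConvexFun_of_eq_iSup {φ : P2 H → EReal} {G : Set (P2 H × ℝ)}
    (hG : ∀ μ, φ μ = ⨆ p ∈ G, ((maxCorr μ p.1 - p.2 : ℝ) : EReal)) :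
    IsConvexFun (fun X : Lp H 2 P => φ (law P X)) := by
  intro X Y t h0 h1
  change φ (law P _) ≤ _
  rw [hG]
  refine iSup₂_le fun p hp => ?_
  have hle : ∀ Z : Lp H 2 P, ((maxCorr (law P Z) p.1 - p.2 : ℝ) : EReal) ≤ φ (law P Z) :=
    fun Z => by rw [hG]; exact le_iSup₂ (f := fun p _ => ((maxCorr _ p.1 - p.2 : ℝ) : EReal)) p hp
  refine le_trans ?_ (add_le_add
    (mul_le_mul_of_nonneg_left (hle X) (EReal.coe_nonneg.2 (sub_nonneg.2 h1)))
    (mul_le_mul_of_nonneg_left (hle Y) (EReal.coe_nonneg.2 h0)))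
  rw [← EReal.coe_mul, ← EReal.coe_mul, ← EReal.coe_add, EReal.coe_le_coe_iff]
  linarith [maxCorr_law_convex p.1 X Y h0 h1]

theorem klf_klf_le (P : Measure Q) [IsProbabilityMeasure P] [NullSingletonClass P]
    {φ : P2 H → EReal} (hφ : ∀ μ, φ μ ≠ ⊥) (μ : P2 H) : klf (klf φ) μ ≤ φ μ := by
  refine iSup_le fun ν => ?_
  rcases eq_or_ne (φ μ) ⊤ with h | h
  · simp [h]
  obtain ⟨r, hr⟩ := EReal.exists_coe_of_ne (hφ μ) h
  have h1 : (maxCorr ν μ : EReal) - φ μ ≤ klf φ ν :=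
    le_iSup (fun μ => (maxCorr ν μ : EReal) - φ μ) μ
  refine (EReal.sub_le_sub le_rfl h1).trans ?_
  rw [hr, maxCorr_comm P μ ν, ← EReal.coe_sub, ← EReal.coe_sub, EReal.coe_le_coe_iff]
  linarith

/-- A totally convex lower semicontinuous function coincides with its biconjugate. -/
theorem eq_klf_klf (P : Measure Q) [IsProbabilityMeasure P] [NullSingletonClass P]
    {φ : P2 H → EReal} (hφ : IsProperFun φ)
    (hc : IsConvexFun (fun X : Lp H 2 P => φ (law P X)))
    (hl : LowerSemicontinuous (fun X : Lp H 2 P => φ (law P X))) : φ = klf (klf φ) := by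
  refine funext fun μ => le_antisymm ?_ (klf_klf_le P hφ.1 μ)
  refine EReal.ge_of_forall_gt_iff_ge.1 fun a ha => ?_
  obtain ⟨X, rfl⟩ := exists_law_eq P μ
  have hprop : IsProperFun (fun X : Lp H 2 P => φ (law P X)) := by
    refine ⟨fun X => hφ.1 _, ?_⟩
    obtain ⟨μ₀, hμ₀⟩ := hφ.2
    obtain ⟨X₀, rfl⟩ := exists_law_eq P μ₀
    exact ⟨X₀, hμ₀⟩
  obtain ⟨y, b, h1, h2⟩ := hc.exists_affine_minorant hl hprop ha
  obtain ⟨Y, rfl⟩ := (InnerProductSpace.toDual ℝ (Lp H 2 P)).surjective y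
  simp only [InnerProductSpace.toDual_apply_apply] at h1 h2
  -- The minorant holds at every `Z` of law `ν`, while `φ` sees only `ν`; taking the supremum over
  -- `Z` turns `inner ℝ Y Z` into the correlation.
  have hconj : klf φ (law P Y) ≤ b := by
    refine iSup_le fun ν => ?_
    rcases eq_or_ne (φ ν) ⊤ with h | h
    · simp [h]
    obtain ⟨r, hr⟩ := EReal.exists_coe_of_ne (hφ.1 ν) h
    rw [hr, ← EReal.coe_sub, EReal.coe_le_coe_iff, sub_le_iff_le_add]
    refine le_of_forall_lt_imp_le_of_dense fun s hs => ?_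
    obtain ⟨Z, rfl, hZ⟩ := exists_lt_inner Y hs
    have := h1 Z
    rw [hr, EReal.coe_le_coe_iff] at this
    linarith
  calc (a : EReal) ≤ ((maxCorr (law P X) (law P Y) - b : ℝ) : EReal) := by
        rw [EReal.coe_le_coe_iff]
        have := inner_le_maxCorr X Y
        rw [real_inner_comm] at this
        linarith
    _ ≤ (maxCorr (law P X) (law P Y) : EReal) - klf φ (law P Y) := by
        rw [EReal.coe_sub]
        exact EReal.sub_le_sub le_rfl hconj
    _ ≤ klf (klf φ) (law P X) :=
        le_iSup (fun ν => (maxCorr (law P X) ν : EReal) - klf φ ν) (law P Y)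

end Standard

end Hilbert

end P2

theorem mainTheorem11
    {H : Type*} [NormedAddCommGroup H] [InnerProductSpace ℝ H] [CompleteSpace H]
    [SecondCountableTopology H] [MeasurableSpace H] [BorelSpace H]
    {Q : Type*} [MeasurableSpace Q] [StandardBorelSpace Q]
    (P : Measure Q) [IsProbabilityMeasure P] [NullSingletonClass P]
    (φ : P2 H → EReal) (hφ : IsProperFun φ) :
    List.TFAE [
      P2.IsTotallyConvex φ ∧ LowerSemicontinuous φ,
      IsConvexFun (fun X : Lp H 2 P => φ (P2.law P X)) ∧
        LowerSemicontinuous (fun X : Lp H 2 P => φ (P2.law P X)),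
      φ = P2.klf (P2.klf φ),
      ∃ G : Set (P2 H × ℝ), ∀ μ : P2 H,
        φ μ = ⨆ p ∈ G, ((P2.maxCorr μ p.1 - p.2 : ℝ) : EReal)] := by
  tfae_have 1 ↔ 2 := by
    rw [P2.isConvexFun_comp_law_iff, P2.lowerSemicontinuous_comp_law_iff]
  tfae_have 2 → 3 := fun h => P2.eq_klf_klf P hφ h.1 h.2
  tfae_have 3 → 4 := fun h =>
    ⟨_, fun μ => (congrFun h μ).trans (P2.klf_eq_iSup (P2.klf_ne_bot hφ) μ)⟩
  tfae_have 4 → 2 := fun ⟨_, hG⟩ =>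
    ⟨P2.isConvexFun_of_eq_iSup hG, P2.lowerSemicontinuous_of_eq_iSup hG⟩
  tfae_finish
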